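/- Let $q$ be a prime power and $n\ge 1$, and equip $\mathbb{F}_q^n$ with the dot product. A subspace $C\le\mathbb{F}_q^n$ is called self-orthogonal if $C\subseteq C^\perp$, and $w$ denotes the Witt index of $(\mathbb{F}_q^n,\cdot)$, that is, the largest dimension of a self-orthogonal subspace. For $m,k\ge 0$ let $\sigma_q(m,k)$ be the number of $k$-dimensional self-orthogonal subspaces of $\mathbb{F}_q^m$ (so $\sigma_q(0,0)=1$). Let $\zeta_q(n,j)$ be the number of vectors $v\in\mathbb{F}_q^n$ of Hamming weight $j$ with $v\cdot v=0$, and let $$A_q^{(j)}(n,k,k)=\sum_{C}\big|\{v\in C \mid v \text{ has Hamming weight } j\}\big|,$$ where $C$ ranges over all $k$-dimensional self-orthogonal subspaces of $\mathbb{F}_q^n$. Set $$\tau_q(m,r,u)=\prod_{i=1}^{r}\frac{(q^{m-u-i}+1)(q^{u-i+1}-1)}{q^i-1},\qquad \tau_q(m,0,u)=1 .$$ The type of $(q,n)$ is $(N_{0,na})$ if $q$ and $n$ are even; $(N_1)$ if $q$ is even and $n$ is odd; $(P)$ if $q$ and $n$ are odd; $(H)$ if $q$ is odd, $n$ is even and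 ($n\equiv 0 \bmod 4$ or $q\equiv 1\bmod 4$); $(E)$ if $n\equiv 2\bmod 4$ and $q\equiv 3\bmod 4$. Let $j>0$ and $1\le k\le w$. Then: (a) If $(q,n)$ is of type $(P)$, $(N_1)$, $(H)$ or $(E)$, then $A_q^{(j)}(n,k,k)=\zeta_q(n,j)\,\tau_q(n-2,k-1,w-1)$. (b) If $(q,n)$ is of type $(N_{0,na})$ and $j<n$, then $A_q^{(j)}(n,k,k)=\zeta_q(n,j)\,\sigma_q(n-2,k-1)$. (c) If $(q,n)$ is of type $(N_{0,na})$ and $j=n$, then $$A_q^{(n)}(n,k,k)=\zeta_q(n,n)\,\sigma_q(n-2,k-1)+(q-1)\big(\sigma_q(n-1,k-1)-\sigma_q(n-2,k-1)\big).$$ In all cases $A_q^{(j)}(n,1,1)=\zeta_q(n,j)$. -/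

import Mathlib

/-! ### Bilinear spaces over a finite field -/

/-- A subspace `C` of `(V, B)` is self-orthogonal if `C ≤ C^⊥`. -/
def IsSelfOrthogonal {F V : Type*} [Field F] [AddCommGroup V] [Module F V]
    (B : LinearMap.BilinForm F V) (C : Submodule F V) : Prop :=
  C ≤ B.orthogonal C

/-- A subspace `C` of `(V, B)` is `l`-complementary if its radical `C ∩ C^⊥` has
dimension `l`. -/
def IsComplementary {F V : Type*} [Field F] [AddCommGroup V] [Module F V]
    (B : LinearMap.BilinForm F V) (l : ℕ) (C : Submodule F V) : Prop :=
  Module.finrank F (C ⊓ B.orthogonal C : Submodule F V) = l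

/-- The Witt index of `(V, B)`: the largest dimension of a self-orthogonal subspace.
For finite-dimensional `V` the set below is bounded, and it contains `0`. -/
noncomputable def wittIndex {F V : Type*} [Field F] [AddCommGroup V] [Module F V]
    (B : LinearMap.BilinForm F V) : ℕ :=
  sSup {d : ℕ | ∃ C : Submodule F V, IsSelfOrthogonal B C ∧ Module.finrank F C = d}

/-- The set `Σ(V, B, k, l)` of `k`-dimensional `l`-complementary subspaces of a finite space. -/
noncomputable def complementarySubspaces {F V : Type*} [Field F] [AddCommGroup V] [Module F V]
    [Finite V] (B : LinearMap.BilinForm F V) (k l : ℕ) : Finset (Submodule F V) :=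
  (Set.toFinite {C : Submodule F V | Module.finrank F C = k ∧ IsComplementary B l C}).toFinset

/-! ### Codes: the space `F^n` with the dot product -/

/-- The standard inner product on `F^n`. -/
def dotForm (F : Type*) [Field F] (n : ℕ) : LinearMap.BilinForm F (Fin n → F) :=
  LinearMap.mk₂ F (fun v w => v ⬝ᵥ w) add_dotProduct smul_dotProduct dotProduct_add
    (fun c v w => dotProduct_smul c v w)

/-- `Σ_q(n, k, l)`: the `l`-complementary `[n, k]` codes over the finite field `F`. -/
noncomputable def codes (F : Type*) [Field F] [Fintype F] (n k l : ℕ) :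
    Finset (Submodule F (Fin n → F)) :=
  complementarySubspaces (dotForm F n) k l

/-- `σ_q(n, k) = |Σ_q(n, k, k)|`: the number of self-orthogonal `[n, k]` codes over `F`. -/
noncomputable def sigmaCount (F : Type*) [Field F] [Fintype F] (n k : ℕ) : ℕ :=
  (codes F n k k).card

/-- `A^(i)(C)`: the number of codewords of `C` of Hamming weight `i`. -/
noncomputable def weightCount {F : Type*} [Field F] [DecidableEq F] {n : ℕ}
    (C : Submodule F (Fin n → F)) (i : ℕ) : ℕ :=
  {v : Fin n → F | v ∈ C ∧ hammingNorm v = i}.ncard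

/-- `A_q^(i)(n, k, l)`: the aggregate weight distribution of the `l`-complementary `[n, k]`
codes over `F`. -/
noncomputable def aggregateWeight (F : Type*) [Field F] [Fintype F] [DecidableEq F]
    (n k l i : ℕ) : ℕ :=
  ∑ C ∈ codes F n k l, weightCount C i

/-- `ζ_q(n, i)`: the number of self-orthogonal vectors of Hamming weight `i` in `F^n`. -/
noncomputable def zetaCount (F : Type*) [Field F] [Fintype F] [DecidableEq F] (n i : ℕ) : ℕ :=
  {v : Fin n → F | hammingNorm v = i ∧ v ⬝ᵥ v = 0}.ncard

/-- `τ_q(n, k, w) = ∏_{i=1}^k (q^(n-w-i) + 1) (q^(w-i+1) - 1) / (q^i - 1)`, where `w ≤ n/2` and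
`k ≤ w`, so that no exponent is negative. The value at `k = 0` is `1`. -/
def tau (q n k w : ℕ) : ℚ :=
  ∏ i ∈ Finset.Icc 1 k,
    (((q : ℚ) ^ (n - w - i) + 1) * ((q : ℚ) ^ (w + 1 - i) - 1)) / ((q : ℚ) ^ i - 1)

/-- The types of the spaces `(F_q^n, ·)`: parabolic, hyperbolic, elliptic (for `q` odd), and
`N_1`, `N_{0,na}` (for `q` even, according to `n` odd or even; the dot product is never
alternating). -/
inductive CodeType
  | P
  | H
  | E
  | N1
  | N0na

/-- The type of the space `(F_q^n, ·)`. The last case is `n ≡ 2` and `q ≡ 3` modulo `4`. -/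
def codeType (q n : ℕ) : CodeType :=
  if q % 2 = 0 then
    if n % 2 = 0 then CodeType.N0na else CodeType.N1
  else if n % 2 = 1 then CodeType.P
  else if n % 4 = 0 ∨ q % 4 = 1 then CodeType.H
  else CodeType.E

/-! Exchanging the order of summation, the aggregate weight is the sum, over isotropic `v` of weight
`j`, of the number of `k`-dimensional self-orthogonal `C` containing `v`. Such a `C` lies in `v^⊥`,
so it corresponds to a `(k-1)`-dimensional self-orthogonal subspace of `v^⊥/v`, realised here as a
complement `U` of the line of `v` in `v^⊥` (`IsResidue.card_filter_mem`). It remains to see how this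
number depends on `v`.

Counting pairs (nonzero vector, subspace) gives a recursion in `k` through residues
(`card_isoSubspaces_mul`), which `tau` also satisfies (`tau_succ_mul`).

For `q` odd, splitting off a hyperbolic plane relates the numbers of isotropic vectors of `W` and of
its residue. Going up, the relation computes the number for `F^n` from its Witt index; going down,
it gives the number for every residue. Neither Witt's theorem nor the distinction between P, H and E
is needed.

For `q` even, the isotropic vectors form the hyperplane `1^⊥`, on which the form is alternating. If
`n` is odd this space is symplectic and all nonzero vectors behave alike. If `n` is even its radical
is the line of the all-one vector `1`: residues at multiples of `1` are counted like `F^(n-1)`, the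
others like `F^(n-2)`. Nonzero multiples of `1` have weight `n`, whence the correction at `j = n`.
-/

open Module

/-! ### Residues of isotropic vectors and double counting. -/

section IsotropicSubspaces

variable {F V : Type*} [Field F] [AddCommGroup V] [Module F V] {B : LinearMap.BilinForm F V}

theorem isSelfOrthogonal_iff {C : Submodule F V} :
    IsSelfOrthogonal B C ↔ ∀ x ∈ C, ∀ y ∈ C, B x y = 0 := by
  constructor
  · intro h x hx y hy
    exact h hy x hx
  · intro h y hy x hx
    exact h x hx y hy

/-- `U` is a complement of the line spanned by the isotropic vector `e` in `W ∩ e^⊥`. -/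
structure IsResidue (B : LinearMap.BilinForm F V) (W : Submodule F V) (e : V)
    (U : Submodule F V) : Prop where
  le : U ≤ W
  mem : e ∈ W
  isotropic : B e e = 0
  orthogonal : ∀ x ∈ U, B e x = 0
  notMem : e ∉ U
  split : ∀ x ∈ W, B e x = 0 → ∃ c : F, x - c • e ∈ U

namespace IsResidue

variable {W U C D : Submodule F V} {e : V}

theorem ne_zero (h : IsResidue B W e U) : e ≠ 0 := fun h0 => h.notMem (h0 ▸ U.zero_mem)

theorem isSelfOrthogonal_sup (hB : B.IsSymm) (h : IsResidue B W e U) (hDU : D ≤ U)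
    (hD : IsSelfOrthogonal B D) : IsSelfOrthogonal B (F ∙ e ⊔ D) := by
  rw [isSelfOrthogonal_iff] at hD ⊢
  intro x hx y hy
  obtain ⟨a, ha, d, hd, rfl⟩ := Submodule.mem_sup.1 hx
  obtain ⟨b, hb, d', hd', rfl⟩ := Submodule.mem_sup.1 hy
  obtain ⟨a, rfl⟩ := Submodule.mem_span_singleton.1 ha
  obtain ⟨b, rfl⟩ := Submodule.mem_span_singleton.1 hb
  have h1 : B d e = 0 := by rw [hB.eq]; exact h.orthogonal d (hDU hd)
  simp [h.isotropic, h.orthogonal d' (hDU hd'), h1, hD d hd d' hd']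

theorem sup_le (h : IsResidue B W e U) (hDU : D ≤ U) : F ∙ e ⊔ D ≤ W :=
  _root_.sup_le ((Submodule.span_singleton_le_iff_mem _ _).2 h.mem) (hDU.trans h.le)

theorem sup_inf (h : IsResidue B W e U) (hDU : D ≤ U) : (F ∙ e ⊔ D) ⊓ U = D := by
  have h0 : (F ∙ e) ⊓ U = ⊥ := by
    rw [← disjoint_iff, disjoint_comm, Submodule.disjoint_span_singleton' h.ne_zero]
    exact h.notMem
  rw [sup_comm, sup_inf_assoc_of_le _ hDU, h0, sup_bot_eq]

theorem span_sup_inf (h : IsResidue B W e U) (hCW : C ≤ W) (hC : IsSelfOrthogonal B C)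
    (he : e ∈ C) : F ∙ e ⊔ (C ⊓ U) = C := by
  rw [isSelfOrthogonal_iff] at hC
  apply le_antisymm
  · exact _root_.sup_le ((Submodule.span_singleton_le_iff_mem _ _).2 he) inf_le_left
  · intro x hx
    obtain ⟨c, hc⟩ := h.split x (hCW hx) (hC e he x hx)
    refine Submodule.mem_sup.2 ⟨c • e, Submodule.smul_mem _ _ (Submodule.mem_span_singleton_self e),
      x - c • e, ⟨C.sub_mem hx (C.smul_mem c he), hc⟩, by abel⟩

theorem finrank_sup [FiniteDimensional F V] (h : IsResidue B W e U) (hDU : D ≤ U) :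
    finrank F (F ∙ e ⊔ D : Submodule F V) = finrank F D + 1 := by
  have h1 := Submodule.finrank_sup_add_finrank_inf_eq (F ∙ e) D
  have h2 : (F ∙ e) ⊓ D = ⊥ := by
    rw [← disjoint_iff, disjoint_comm, Submodule.disjoint_span_singleton' h.ne_zero]
    exact fun he => h.notMem (hDU he)
  rw [h2, finrank_bot, finrank_span_singleton h.ne_zero] at h1
  omega

end IsResidue

variable [Finite V]

/-- The `k`-dimensional self-orthogonal subspaces of `W`. -/
noncomputable def isoSubspaces (B : LinearMap.BilinForm F V) (W : Submodule F V) (k : ℕ) :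
    Finset (Submodule F V) :=
  (Set.toFinite {C : Submodule F V | C ≤ W ∧ IsSelfOrthogonal B C ∧ finrank F C = k}).toFinset

/-- The nonzero isotropic vectors of `W`. -/
noncomputable def isoVectors (B : LinearMap.BilinForm F V) (W : Submodule F V) : Finset V :=
  (Set.toFinite {x : V | x ∈ W ∧ x ≠ 0 ∧ B x x = 0}).toFinset

@[simp] theorem mem_isoSubspaces {W C : Submodule F V} {k : ℕ} :
    C ∈ isoSubspaces B W k ↔ C ≤ W ∧ IsSelfOrthogonal B C ∧ finrank F C = k := by
  simp [isoSubspaces]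

@[simp] theorem mem_isoVectors {W : Submodule F V} {x : V} :
    x ∈ isoVectors B W ↔ x ∈ W ∧ x ≠ 0 ∧ B x x = 0 := by
  simp [isoVectors]

theorem card_isoSubspaces_zero (W : Submodule F V) : (isoSubspaces B W 0).card = 1 := by
  rw [Finset.card_eq_one]
  refine ⟨⊥, ?_⟩
  ext C
  simp only [mem_isoSubspaces, Finset.mem_singleton, Submodule.finrank_eq_zero]
  constructor
  · exact fun h => h.2.2
  · rintro rfl
    exact ⟨bot_le, by simp [IsSelfOrthogonal], rfl⟩

-- Adding the line of `e` and intersecting with `U` are mutually inverse, because a self-orthogonal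
-- subspace of `W` containing `e` lies in `W ∩ e^⊥ = ⟨e⟩ ⊕ U`.
open Classical in
theorem IsResidue.card_filter_mem (hB : B.IsSymm) {W U : Submodule F V} {e : V}
    (h : IsResidue B W e U) (k : ℕ) :
    ((isoSubspaces B W (k + 1)).filter (e ∈ ·)).card = (isoSubspaces B U k).card := by
  symm
  apply Finset.card_bij' (fun D _ => F ∙ e ⊔ D) (fun C _ => C ⊓ U)
  · intro D hD
    simp only [mem_isoSubspaces] at hD
    simp only [Finset.mem_filter, mem_isoSubspaces]
    refine ⟨⟨h.sup_le hD.1, h.isSelfOrthogonal_sup hB hD.1 hD.2.1, ?_⟩,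
      Submodule.mem_sup_left (Submodule.mem_span_singleton_self e)⟩
    rw [h.finrank_sup hD.1, hD.2.2]
  · intro C hC
    simp only [Finset.mem_filter, mem_isoSubspaces] at hC
    obtain ⟨⟨hCW, hC, hk⟩, he⟩ := hC
    simp only [mem_isoSubspaces]
    refine ⟨inf_le_right, ?_, ?_⟩
    · rw [isSelfOrthogonal_iff] at hC ⊢
      exact fun x hx y hy => hC x hx.1 y hy.1
    · have := h.finrank_sup (D := C ⊓ U) inf_le_right
      rw [h.span_sup_inf hCW hC he] at this
      omega
  · intro D hD
    simp only [mem_isoSubspaces] at hD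
    exact h.sup_inf hD.1
  · intro C hC
    simp only [Finset.mem_filter, mem_isoSubspaces] at hC
    exact h.span_sup_inf hC.1.1 hC.1.2.1 hC.2

-- Double count of the pairs `e ∈ C`: each `C` has `q^k - 1` nonzero vectors, all of them isotropic.
open Classical in
theorem card_isoSubspaces_mul [Fintype F] (W : Submodule F V) (k : ℕ) :
    (((Fintype.card F : ℚ)) ^ k - 1) * (isoSubspaces B W k).card =
      ∑ e ∈ isoVectors B W, (((isoSubspaces B W k).filter (e ∈ ·)).card : ℚ) := by
  have h := Finset.sum_card_bipartiteAbove_eq_sum_card_bipartiteBelow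
    (s := isoSubspaces B W k) (t := isoVectors B W) (fun C e => e ∈ C)
  simp only [Finset.bipartiteAbove, Finset.bipartiteBelow] at h
  rw [← Nat.cast_sum, ← h, Nat.cast_sum, mul_comm, ← nsmul_eq_mul]
  symm
  apply Finset.sum_eq_card_nsmul
  intro C hC
  obtain ⟨hCW, hC, hk⟩ := mem_isoSubspaces.1 hC
  rw [isSelfOrthogonal_iff] at hC
  have : Fintype V := Fintype.ofFinite V
  have h1 : (isoVectors B W).filter (· ∈ C) = (Finset.univ.filter (· ∈ C)).erase 0 := by
    ext x
    simp only [Finset.mem_filter, mem_isoVectors, Finset.mem_erase, Finset.mem_univ, true_and]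
    exact ⟨fun h => ⟨h.1.2.1, h.2⟩, fun h => ⟨⟨hCW h.2, h.1, hC x h.2 x h.2⟩, h.2⟩⟩
  have h2 : (Finset.univ.filter (· ∈ C)).card = Fintype.card F ^ k := by
    rw [← hk, ← Module.card_eq_pow_finrank (K := F) (V := C), ← Fintype.card_subtype]
  have h3 : (0 : V) ∈ Finset.univ.filter (· ∈ C) := by simp
  have := Finset.card_erase_add_one h3
  rw [h1, eq_sub_iff_add_eq]
  exact_mod_cast this.trans h2

end IsotropicSubspaces

/-! ### The recursion for `tau`. -/

theorem Finset.prod_Icc_one_eq_prod_range {M : Type*} [CommMonoid M] (f : ℕ → M) (k : ℕ) :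
    ∏ i ∈ Finset.Icc 1 k, f i = ∏ i ∈ Finset.range k, f (i + 1) := by
  induction k with
  | zero => simp
  | succ k ih => rw [Finset.prod_Icc_succ_top (by omega), ih, Finset.prod_range_succ]

theorem tau_zero (q m u : ℕ) : tau q m 0 u = 1 := by simp [tau]

theorem tau_succ_mul {q : ℕ} (hq : 2 ≤ q) (m k u : ℕ) :
    ((q : ℚ) ^ (k + 1) - 1) * tau q m (k + 1) u =
      ((q : ℚ) ^ (m - u - 1) + 1) * ((q : ℚ) ^ u - 1) * tau q (m - 2) k (u - 1) := by
  have hne : ∀ i : ℕ, (q : ℚ) ^ (i + 1) - 1 ≠ 0 := fun i => by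
    have : (1 : ℚ) < (q : ℚ) ^ (i + 1) :=
      one_lt_pow₀ (by exact_mod_cast hq) (by omega)
    linarith
  unfold tau
  -- For `u = 0` the truncated `u - 1` is harmless, since both sides contain the factor `q^0 - 1`.
  rcases Nat.eq_zero_or_pos u with rfl | hu
  · have : ∏ i ∈ Finset.Icc 1 (k + 1),
        (((q : ℚ) ^ (m - 0 - i) + 1) * ((q : ℚ) ^ (0 + 1 - i) - 1)) / ((q : ℚ) ^ i - 1) = 0 :=
      Finset.prod_eq_zero (i := 1) (by simp) (by simp)
    rw [this]
    simp
  · rw [Finset.prod_Icc_one_eq_prod_range, Finset.prod_Icc_one_eq_prod_range,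
      Finset.prod_div_distrib, Finset.prod_div_distrib,
      Finset.prod_range_succ' (fun i => ((q : ℚ) ^ (m - u - (i + 1)) + 1) *
        ((q : ℚ) ^ (u + 1 - (i + 1)) - 1)),
      Finset.prod_range_succ (fun i => (q : ℚ) ^ (i + 1) - 1)]
    have h1 : ∀ i, m - u - (i + 1 + 1) = m - 2 - (u - 1) - (i + 1) := fun i => by omega
    have h2 : ∀ i, u + 1 - (i + 1 + 1) = u - 1 + 1 - (i + 1) := fun i => by omega
    simp only [h1, h2]
    have h3 : ∏ i ∈ Finset.range k, ((q : ℚ) ^ (i + 1) - 1) ≠ 0 :=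
      Finset.prod_ne_zero_iff.2 fun i _ => hne i
    have h4 := hne k
    have h5 : m - u - (0 + 1) = m - u - 1 := rfl
    have h6 : u + 1 - (0 + 1) = u := by omega
    rw [h5, h6]
    field_simp

/-! ### Counting by residues, and hyperbolic pairs. -/

section HyperbolicPlanes

variable {F V : Type*} [Field F] [AddCommGroup V] [Module F V] {B : LinearMap.BilinForm F V}

/-- The induction needs only a class `P` of spaces closed under residues with a prescribed number of
isotropic vectors. It serves both the odd and the symplectic case. -/
theorem card_isoSubspaces_eq_tau [Finite V] [Fintype F] (hB : B.IsSymm)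
    (P : Submodule F V → ℕ → ℕ → Prop)
    (hcount : ∀ W m u, P W m u → ((isoVectors B W).card : ℚ) =
      ((Fintype.card F : ℚ) ^ (m - u - 1) + 1) * ((Fintype.card F : ℚ) ^ u - 1))
    (hres : ∀ W m u, P W m u → ∀ e ∈ isoVectors B W,
      ∃ U, IsResidue B W e U ∧ P U (m - 2) (u - 1))
    (k : ℕ) : ∀ W m u, P W m u →
      ((isoSubspaces B W k).card : ℚ) = tau (Fintype.card F) m k u := by
  classical
  have hq : 2 ≤ Fintype.card F := Fintype.one_lt_card
  induction k with
  | zero => intro W m u _; rw [card_isoSubspaces_zero, tau_zero, Nat.cast_one]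
  | succ k ih =>
    intro W m u hP
    have h1 := card_isoSubspaces_mul (B := B) W (k + 1)
    rw [Finset.sum_congr rfl (g := fun _ => tau (Fintype.card F) (m - 2) k (u - 1)),
      Finset.sum_const, nsmul_eq_mul, hcount W m u hP, ← tau_succ_mul hq] at h1
    · refine mul_left_cancel₀ ?_ h1
      have : (1 : ℚ) < (Fintype.card F : ℚ) ^ (k + 1) :=
        one_lt_pow₀ (by exact_mod_cast hq) (by omega)
      linarith
    · intro e he
      obtain ⟨U, hU, hPU⟩ := hres W m u hP e he
      rw [← ih U _ _ hPU, hU.card_filter_mem hB]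

/-- The orthogonal complement in `W` of the vectors `e` and `f`. -/
def orthogonalPair (B : LinearMap.BilinForm F V) (W : Submodule F V) (e f : V) :
    Submodule F V :=
  W ⊓ (LinearMap.ker (B e) ⊓ LinearMap.ker (B f))

@[simp] theorem mem_orthogonalPair {W : Submodule F V} {e f x : V} :
    x ∈ orthogonalPair B W e f ↔ x ∈ W ∧ B e x = 0 ∧ B f x = 0 := by
  simp [orthogonalPair]

/-- `e, f` is a hyperbolic pair of `W`. -/
structure IsHyperbolicPair (B : LinearMap.BilinForm F V) (W : Submodule F V) (e f : V) :
    Prop where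
  left_mem : e ∈ W
  right_mem : f ∈ W
  left : B e e = 0
  right : B f f = 0
  left_right : B e f = 1
  right_left : B f e = 1

namespace IsHyperbolicPair

variable {W : Submodule F V} {e f : V}

theorem isResidue (h : IsHyperbolicPair B W e f) :
    IsResidue B W e (orthogonalPair B W e f) where
  le := inf_le_left
  mem := h.left_mem
  isotropic := h.left
  orthogonal x hx := (mem_orthogonalPair.1 hx).2.1
  notMem he := one_ne_zero (h.right_left.symm.trans (mem_orthogonalPair.1 he).2.2)
  split x hx hex := ⟨B f x, by
    simp [hex, h.left, h.right_left, W.sub_mem hx (W.smul_mem (B f x) h.left_mem)]⟩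

theorem sub_mem (h : IsHyperbolicPair B W e f) {x : V} (hx : x ∈ W) :
    x - B f x • e - B e x • f ∈ orthogonalPair B W e f := by
  simp [h.left, h.right_left, h.left_right, h.right, W.sub_mem (W.sub_mem hx
    (W.smul_mem (B f x) h.left_mem)) (W.smul_mem (B e x) h.right_mem)]

theorem eq_of_add (h : IsHyperbolicPair B W e f) {a b : F} {y : V}
    (hy : y ∈ orthogonalPair B W e f) :
    B f (a • e + b • f + y) = a ∧ B e (a • e + b • f + y) = b := by
  obtain ⟨-, h1, h2⟩ := mem_orthogonalPair.1 hy
  simp [h.left, h.right_left, h.left_right, h.right, h1, h2]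

/-- Coordinates with respect to a hyperbolic pair. -/
def equiv (h : IsHyperbolicPair B W e f) : W ≃ₗ[F] (F × F) × orthogonalPair B W e f where
  toFun x := ((B f x, B e x), ⟨_, h.sub_mem x.2⟩)
  map_add' x y := by
    ext <;> simp
    module
  map_smul' c x := by
    ext <;> simp
    module
  invFun y := ⟨y.1.1 • e + y.1.2 • f + y.2, W.add_mem (W.add_mem (W.smul_mem _ h.left_mem)
    (W.smul_mem _ h.right_mem)) (mem_orthogonalPair.1 y.2.2).1⟩
  left_inv x := by
    ext
    simp
  right_inv y := by
    have := h.eq_of_add (a := y.1.1) (b := y.1.2) y.2.2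
    ext
    · exact this.1
    · exact this.2
    · change y.1.1 • e + y.1.2 • f + y.2 - B f _ • e - B e _ • f = (y.2 : V)
      rw [this.1, this.2]
      abel

theorem finrank_add_two [FiniteDimensional F V] (h : IsHyperbolicPair B W e f) :
    finrank F (orthogonalPair B W e f) + 2 = finrank F W := by
  rw [h.equiv.finrank_eq]
  simp
  omega

/-- A vector of `W` that is orthogonal to `e`, `f` and their complement is orthogonal to `W`. -/
theorem eq_zero_of_orthogonal (h : IsHyperbolicPair B W e f) (hB : B.IsSymm) {x : V}
    (hx : x ∈ orthogonalPair B W e f) (h0 : ∀ y ∈ orthogonalPair B W e f, B x y = 0) :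
    ∀ y ∈ W, B x y = 0 := by
  intro y hy
  obtain ⟨-, h1, h2⟩ := mem_orthogonalPair.1 hx
  have := h0 _ (h.sub_mem hy)
  rw [map_sub, map_sub, map_smul, map_smul, ← hB.eq e x, ← hB.eq f x] at this
  simpa [h1, h2] using this

theorem apply_self_add (h : IsHyperbolicPair B W e f) (hB : B.IsSymm) (a b : F) {y : V}
    (hy : y ∈ orthogonalPair B W e f) :
    B (a • e + b • f + y) (a • e + b • f + y) = 2 * (a * b) + B y y := by
  obtain ⟨-, h1, h2⟩ := mem_orthogonalPair.1 hy
  have h3 : B y e = 0 := by rw [hB.eq]; exact h1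
  have h4 : B y f = 0 := by rw [hB.eq]; exact h2
  simp [h1, h2, h3, h4, h.left, h.right, h.left_right, h.right_left]
  ring

end IsHyperbolicPair

end HyperbolicPlanes

/-! ### Nondegenerate spaces in odd characteristic. -/

section OddCharacteristic

variable {F V : Type*} [Field F] [AddCommGroup V] [Module F V] {B : LinearMap.BilinForm F V}
  {W : Submodule F V} {e f : V}

/-- The restriction of `B` to `W` is nondegenerate. -/
def IsNondegenerateOn (B : LinearMap.BilinForm F V) (W : Submodule F V) : Prop :=
  ∀ x ∈ W, (∀ y ∈ W, B x y = 0) → x = 0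

theorem IsNondegenerateOn.orthogonalPair (hW : IsNondegenerateOn B W) (hB : B.IsSymm)
    (h : IsHyperbolicPair B W e f) : IsNondegenerateOn B (orthogonalPair B W e f) :=
  fun x hx h0 => hW x (mem_orthogonalPair.1 hx).1 (h.eq_zero_of_orthogonal hB hx h0)

theorem exists_apply_eq_one {W : Submodule F V} {e : V} (h : ∃ y ∈ W, B e y ≠ 0) :
    ∃ y ∈ W, B e y = 1 := by
  obtain ⟨y, hy, h⟩ := h
  exact ⟨(B e y)⁻¹ • y, W.smul_mem _ hy, by simp [h]⟩

theorem IsNondegenerateOn.exists_apply_eq_one (hW : IsNondegenerateOn B W) (he : e ∈ W)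
    (he0 : e ≠ 0) : ∃ y ∈ W, B e y = 1 := by
  refine _root_.exists_apply_eq_one ?_
  by_contra! h
  exact he0 (hW e he h)

theorem IsNondegenerateOn.exists_isHyperbolicPair (hW : IsNondegenerateOn B W) (hB : B.IsSymm)
    (h2 : (2 : F) ≠ 0) (he : e ∈ W) (he0 : e ≠ 0) (hee : B e e = 0) :
    ∃ f, IsHyperbolicPair B W e f := by
  obtain ⟨f, hf, hef⟩ := hW.exists_apply_eq_one he he0
  have hfe : B f e = 1 := by rw [hB.eq]; exact hef
  -- Moving `f` along `e` keeps its product with `e` and shifts `B f f`; this multiple makes it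
  -- vanish.
  refine ⟨f - (B f f / 2) • e, he, W.sub_mem hf (W.smul_mem _ he), hee, ?_, ?_, ?_⟩
  · simp [hfe, hef, hee]
    field_simp
    ring
  · simp [hef, hee]
  · simp [hfe, hee]

variable [Fintype F] [Finite V]

omit [Fintype F] in
theorem card_isoVectors_add_one (W : Submodule F V) :
    (isoVectors B W).card + 1 = Nat.card {x : W // B x x = 0} := by
  classical
  have h0 : (0 : V) ∉ isoVectors B W := by simp
  have h1 : ∀ x, x ∈ insert 0 (isoVectors B W) ↔ x ∈ W ∧ B x x = 0 := fun x => by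
    rw [Finset.mem_insert, mem_isoVectors]
    by_cases hx : x = 0
    · simp [hx]
    · simp [hx]
  rw [← Finset.card_insert_of_notMem h0, ← Nat.card_eq_finsetCard]
  exact Nat.card_congr
    { toFun := fun x => ⟨⟨x, ((h1 x).1 x.2).1⟩, ((h1 x).1 x.2).2⟩
      invFun := fun x => ⟨x.1, (h1 _).2 ⟨x.1.2, x.2⟩⟩
      left_inv := fun _ => rfl
      right_inv := fun _ => rfl }

/-- The vector `a e + b f + y` is isotropic iff `2ab + B y y = 0`. If `b ≠ 0`, then `y` is arbitrary
and determines `a`; if `b = 0`, then `a` is free and `y` is isotropic. The `+ 1` accounts for the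
zero vector. -/
theorem IsHyperbolicPair.card_isoVectors (h : IsHyperbolicPair B W e f) (hB : B.IsSymm)
    (h2 : (2 : F) ≠ 0) :
    (isoVectors B W).card + 1 = (Fintype.card F - 1) *
      Fintype.card F ^ (finrank F W - 2) +
      Fintype.card F * ((isoVectors B (orthogonalPair B W e f)).card + 1) := by
  classical
  have : Fintype V := Fintype.ofFinite V
  set U := orthogonalPair B W e f with hU
  have hr : finrank F W - 2 = finrank F U := by
    have : finrank F U + 2 = finrank F W := h.finrank_add_two
    omega
  rw [card_isoVectors_add_one, card_isoVectors_add_one, hr]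
  have hcU : Nat.card U = Fintype.card F ^ finrank F U := by
    rw [Nat.card_eq_fintype_card]; exact Module.card_eq_pow_finrank
  have hcF : Nat.card Fˣ = Fintype.card F - 1 := by
    rw [Nat.card_eq_fintype_card, Fintype.card_units]
  rw [← hcU, ← hcF, ← Nat.card_eq_fintype_card (α := F), ← Nat.card_prod, ← Nat.card_prod,
    ← Nat.card_sum]
  symm
  let g : (Fˣ × U) ⊕ (F × {x : U // B x x = 0}) → {x : W // B x x = 0} := fun z =>
    match z with
    | .inl (b, y) => ⟨h.equiv.symm ((-(B y y) / (2 * b), b), y), by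
        change B ((-(B y y) / (2 * (b : F))) • e + (b : F) • f + y)
          ((-(B y y) / (2 * (b : F))) • e + (b : F) • f + y) = 0
        rw [h.apply_self_add hB _ _ y.2]
        field_simp
        ring⟩
    | .inr (a, y) => ⟨h.equiv.symm ((a, 0), y), by
        change B (a • e + (0 : F) • f + y) (a • e + (0 : F) • f + y) = 0
        rw [h.apply_self_add hB _ _ y.1.2, y.2]
        ring⟩
  refine Nat.card_eq_of_bijective g ⟨?_, ?_⟩
  · rintro (⟨b, y⟩ | ⟨a, y⟩) (⟨b', y'⟩ | ⟨a', y'⟩) hg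
    all_goals
      have hg := h.equiv.symm.injective (Subtype.ext_iff.1 hg)
      simp only [Prod.mk.injEq] at hg
    · obtain ⟨⟨-, h1⟩, h3⟩ := hg
      rw [Units.ext h1, h3]
    · exact absurd hg.1.2 b.ne_zero
    · exact absurd hg.1.2.symm b'.ne_zero
    · rw [hg.1.1, Subtype.ext hg.2]
  · rintro ⟨x, hx⟩
    obtain ⟨⟨⟨a, b⟩, y⟩, rfl⟩ := h.equiv.symm.surjective x
    have hx' : B (a • e + b • f + y) (a • e + b • f + y) = 0 := hx
    rw [h.apply_self_add hB _ _ y.2] at hx'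
    by_cases hb : b = 0
    · subst hb
      exact ⟨.inr (a, ⟨y, by simpa using hx'⟩), rfl⟩
    · refine ⟨.inl (Units.mk0 b hb, y), Subtype.ext ?_⟩
      have : -(B y y) / (2 * b) = a := by
        field_simp
        linear_combination -hx'
      change h.equiv.symm ((-(B y y) / (2 * b), b), y) = _
      rw [this]

/-- `C` is maximal among the self-orthogonal subspaces of `W`. -/
def IsMaximalIsotropic (B : LinearMap.BilinForm F V) (W C : Submodule F V) : Prop :=
  Maximal (fun D => D ≤ W ∧ IsSelfOrthogonal B D) C

omit [Fintype F] [Finite V] in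
theorem IsMaximalIsotropic.inf {C U : Submodule F V} (hC : IsMaximalIsotropic B W C)
    (hB : B.IsSymm) (h : IsResidue B W e U) (he : e ∈ C) : IsMaximalIsotropic B U (C ⊓ U) := by
  have h1 := isSelfOrthogonal_iff.1 hC.prop.2
  refine ⟨⟨inf_le_right, isSelfOrthogonal_iff.2 fun x hx y hy => h1 x hx.1 y hy.1⟩, ?_⟩
  rintro D ⟨hDU, hD⟩ hle
  refine le_inf ?_ hDU
  have h2 : C ≤ F ∙ e ⊔ D := by
    rw [← h.span_sup_inf hC.prop.1 hC.prop.2 he]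
    exact sup_le_sup_left hle _
  exact le_sup_right.trans
    (hC.le_of_ge ⟨h.sup_le hDU, h.isSelfOrthogonal_sup hB hDU hD⟩ h2)

omit [Fintype F] in
theorem IsResidue.finrank_inf_add_one {C U : Submodule F V}
    (h : IsResidue B W e U) (hCW : C ≤ W) (hC : IsSelfOrthogonal B C) (he : e ∈ C) :
    finrank F (C ⊓ U : Submodule F V) + 1 = finrank F C := by
  rw [← h.finrank_sup inf_le_right, h.span_sup_inf hCW hC he]

omit [Fintype F] in
theorem IsMaximalIsotropic.isoVectors_eq_empty (hC : IsMaximalIsotropic B W ⊥) :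
    isoVectors B W = ∅ := by
  rw [Finset.eq_empty_iff_forall_notMem]
  intro x hx
  obtain ⟨hx, hx0, hxx⟩ := mem_isoVectors.1 hx
  have : F ∙ x ≤ ⊥ := by
    refine hC.le_of_ge ⟨(Submodule.span_singleton_le_iff_mem _ _).2 hx, ?_⟩ bot_le
    rw [isSelfOrthogonal_iff]
    intro y hy z hz
    obtain ⟨a, rfl⟩ := Submodule.mem_span_singleton.1 hy
    obtain ⟨b, rfl⟩ := Submodule.mem_span_singleton.1 hz
    simp [hxx]
  exact hx0 ((Submodule.mem_bot F).1 ((Submodule.span_singleton_le_iff_mem _ _).1 this))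

/-- Splitting off a hyperbolic plane through some `e ∈ C` leaves `C ∩ U` maximal in the residue `U`,
one dimension smaller. At `C = 0` there are no nonzero isotropic vectors. -/
theorem IsMaximalIsotropic.card_isoVectors (hB : B.IsSymm) (h2 : (2 : F) ≠ 0) (u : ℕ) :
    ∀ W C : Submodule F V, IsNondegenerateOn B W → IsMaximalIsotropic B W C →
      finrank F C = u → 2 * u ≤ finrank F W ∧ ((isoVectors B W).card : ℚ) =
        ((Fintype.card F : ℚ) ^ (finrank F W - u - 1) + 1) * ((Fintype.card F : ℚ) ^ u - 1) := by
  induction u with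
  | zero =>
    intro W C _ hC hu
    rw [Submodule.finrank_eq_zero] at hu
    subst hu
    simp [hC.isoVectors_eq_empty]
  | succ u ih =>
    intro W C hW hC hu
    obtain ⟨e, he, he0⟩ : ∃ e ∈ C, e ≠ 0 := C.exists_mem_ne_zero_of_ne_bot (by
      rintro rfl
      simp at hu)
    have hee := isSelfOrthogonal_iff.1 hC.prop.2 e he e he
    obtain ⟨f, hf⟩ := hW.exists_isHyperbolicPair hB h2 (hC.prop.1 he) he0 hee
    have hr := hf.isResidue
    have h3 := hf.finrank_add_two
    have h4 := hr.finrank_inf_add_one hC.prop.1 hC.prop.2 he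
    obtain ⟨h5, h6⟩ := ih _ _ (hW.orthogonalPair hB hf) (hC.inf hB hr he) (by omega)
    refine ⟨by omega, ?_⟩
    have h7 := congrArg (Nat.cast (R := ℚ)) (hf.card_isoVectors hB h2)
    have h8 : 1 ≤ Fintype.card F := Fintype.card_pos
    push_cast [h8] at h7
    rw [h6] at h7
    rw [eq_sub_of_add_eq h7]
    obtain ⟨t, ht⟩ := Nat.exists_eq_add_of_le h5
    rw [← h3, ht, show 2 * u + t + 2 - 2 = 2 * u + t by omega,
      show 2 * u + t + 2 - (u + 1) - 1 = u + t by omega]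
    -- The exponent `u + t - 1` for the residue truncates when `u = t = 0`; there its factor `q^u -
    -- 1` vanishes.
    rcases Nat.eq_zero_or_pos (u + t) with h9 | h9
    · obtain ⟨rfl, rfl⟩ : u = 0 ∧ t = 0 := by omega
      simp
      ring
    · obtain ⟨s, hs⟩ := Nat.exists_eq_add_of_le h9
      rw [show 2 * u + t - u - 1 = s by omega, show 2 * u + t = u + (s + 1) by omega, hs]
      ring

/-- `W` is nondegenerate of dimension `m` and has as many isotropic vectors as a polar space of
Witt index `u`. -/
structure HasPolarCount (B : LinearMap.BilinForm F V) (W : Submodule F V) (m u : ℕ) : Prop where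
  nondegenerate : IsNondegenerateOn B W
  finrank_eq : finrank F W = m
  two_mul_le : 2 * u ≤ m
  card_eq : ((isoVectors B W).card : ℚ) =
    ((Fintype.card F : ℚ) ^ (m - u - 1) + 1) * ((Fintype.card F : ℚ) ^ u - 1)

/-- The same relation solved for the residue: its count follows from that of `W`, whichever `e` was
chosen. -/
theorem HasPolarCount.exists_isResidue (hB : B.IsSymm) (h2 : (2 : F) ≠ 0) {m u : ℕ}
    (h : HasPolarCount B W m u) (hemem : e ∈ isoVectors B W) :
    ∃ U, IsResidue B W e U ∧ HasPolarCount B U (m - 2) (u - 1) := by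
  obtain ⟨hW, rfl, hu, hcard⟩ := h
  obtain ⟨he, he0, hee⟩ := mem_isoVectors.1 hemem
  obtain ⟨f, hf⟩ := hW.exists_isHyperbolicPair hB h2 he he0 hee
  have h3 := hf.finrank_add_two
  have hupos : u ≠ 0 := by
    rintro rfl
    rw [pow_zero, sub_self, mul_zero, Nat.cast_eq_zero, Finset.card_eq_zero] at hcard
    simp [hcard] at hemem
  obtain ⟨v, rfl⟩ : ∃ v, u = v + 1 := ⟨u - 1, by omega⟩
  refine ⟨_, hf.isResidue, hW.orthogonalPair hB hf, by omega, by omega, ?_⟩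
  have h7 := congrArg (Nat.cast (R := ℚ)) (hf.card_isoVectors hB h2)
  have h8 : 1 ≤ Fintype.card F := Fintype.card_pos
  have h9 : (Fintype.card F : ℚ) ≠ 0 := by positivity
  push_cast [h8] at h7
  rw [hcard] at h7
  refine mul_left_cancel₀ h9 ?_
  rw [← sub_eq_zero] at h7 ⊢
  refine Eq.trans ?_ (neg_eq_zero.2 h7)
  obtain ⟨t, ht⟩ := Nat.exists_eq_add_of_le hu
  rw [ht, show 2 * (v + 1) + t - 2 = 2 * v + t by omega,
    show 2 * (v + 1) + t - (v + 1) - 1 = v + t by omega]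
  rcases Nat.eq_zero_or_pos (v + t) with h10 | h10
  · obtain ⟨rfl, rfl⟩ : v = 0 ∧ t = 0 := by omega
    simp
    ring
  · obtain ⟨s, hs⟩ := Nat.exists_eq_add_of_le h10
    rw [show v + 1 - 1 = v from rfl, show 2 * v + t - v - 1 = s by omega,
      show 2 * v + t = v + (s + 1) by omega, hs]
    ring

theorem HasPolarCount.card_isoSubspaces (hB : B.IsSymm) (h2 : (2 : F) ≠ 0) {m u : ℕ}
    (h : HasPolarCount B W m u) (k : ℕ) :
    ((isoSubspaces B W k).card : ℚ) = tau (Fintype.card F) m k u :=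
  card_isoSubspaces_eq_tau hB (HasPolarCount B) (fun _ _ _ h => h.card_eq)
    (fun _ _ _ h _ he => h.exists_isResidue hB h2 he) k W m u h

end OddCharacteristic

/-! ### Alternating spaces: symplectic, or with a radical of dimension one. -/

section Alternating

variable {F V : Type*} [Field F] [AddCommGroup V] [Module F V] {B : LinearMap.BilinForm F V}
  {W : Submodule F V} {e f r : V}

/-- The restriction of `B` to `W` is alternating. -/
def IsAlternatingOn (B : LinearMap.BilinForm F V) (W : Submodule F V) : Prop :=
  ∀ x ∈ W, B x x = 0

theorem IsAlternatingOn.mono {U : Submodule F V} (h : IsAlternatingOn B W) (hU : U ≤ W) :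
    IsAlternatingOn B U :=
  fun x hx => h x (hU hx)

theorem IsAlternatingOn.isHyperbolicPair (h : IsAlternatingOn B W) (hB : B.IsSymm)
    (he : e ∈ W) (hf : f ∈ W) (hef : B e f = 1) : IsHyperbolicPair B W e f :=
  ⟨he, hf, h e he, h f hf, hef, by rw [hB.eq]; exact hef⟩

/-- `W` is a nondegenerate alternating space of dimension `2u`. -/
structure IsSymplecticOn (B : LinearMap.BilinForm F V) (W : Submodule F V) (u : ℕ) : Prop where
  alternating : IsAlternatingOn B W
  nondegenerate : IsNondegenerateOn B W
  finrank_eq : finrank F W = 2 * u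

/-- `W` is an alternating space of dimension `2u + 1` whose radical is spanned by `r`. -/
structure IsDegenerateOn (B : LinearMap.BilinForm F V) (W : Submodule F V) (r : V) (u : ℕ) :
    Prop where
  alternating : IsAlternatingOn B W
  mem : r ∈ W
  ne_zero : r ≠ 0
  orthogonal : ∀ y ∈ W, B r y = 0
  radical : ∀ x ∈ W, (∀ y ∈ W, B x y = 0) → x ∈ F ∙ r
  finrank_eq : finrank F W = 2 * u + 1

theorem IsAlternatingOn.exists_isResidue [FiniteDimensional F V] (hW : IsAlternatingOn B W)
    (hB : B.IsSymm) (h : IsNondegenerateOn B W) (he : e ∈ W) (he0 : e ≠ 0) :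
    ∃ U, IsResidue B W e U ∧ IsAlternatingOn B U ∧ IsNondegenerateOn B U ∧
      finrank F U + 2 = finrank F W := by
  obtain ⟨f, hf, hef⟩ := h.exists_apply_eq_one he he0
  have hp := hW.isHyperbolicPair hB he hf hef
  exact ⟨_, hp.isResidue, hW.mono hp.isResidue.le, h.orthogonalPair hB hp, hp.finrank_add_two⟩

theorem IsSymplecticOn.exists_isResidue [FiniteDimensional F V] {u : ℕ}
    (h : IsSymplecticOn B W u) (hB : B.IsSymm) (he : e ∈ W) (he0 : e ≠ 0) :
    ∃ U, IsResidue B W e U ∧ IsSymplecticOn B U (u - 1) ∧ u ≠ 0 := by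
  obtain ⟨U, hU, h1, h2, h3⟩ := h.alternating.exists_isResidue hB h.nondegenerate he he0
  have := h.finrank_eq
  exact ⟨U, hU, ⟨h1, h2, by omega⟩, by omega⟩

/-- Outside the radical `e` has a hyperbolic partner, and `r` survives as the radical of the
complement of the plane. -/
theorem IsDegenerateOn.exists_isResidue [FiniteDimensional F V] {u : ℕ}
    (h : IsDegenerateOn B W r u) (hB : B.IsSymm) (he : e ∈ W) (her : e ∉ F ∙ r) :
    ∃ U, IsResidue B W e U ∧ IsDegenerateOn B U r (u - 1) ∧ u ≠ 0 := by
  obtain ⟨f, hf, hef⟩ : ∃ f ∈ W, B e f = 1 := by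
    refine exists_apply_eq_one ?_
    by_contra! h0
    exact her (h.radical e he h0)
  have hp := h.alternating.isHyperbolicPair hB he hf hef
  have h3 := hp.finrank_add_two
  have h4 := h.finrank_eq
  refine ⟨_, hp.isResidue, ⟨h.alternating.mono hp.isResidue.le, ?_, h.ne_zero,
    fun y hy => h.orthogonal y (hp.isResidue.le hy),
    fun x hx h0 => h.radical x (hp.isResidue.le hx) (hp.eq_zero_of_orthogonal hB hx h0),
    by omega⟩, by omega⟩
  rw [mem_orthogonalPair]
  exact ⟨h.mem, by rw [hB.eq]; exact h.orthogonal e he, by rw [hB.eq]; exact h.orthogonal f hf⟩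

/-- Here `e` is orthogonal to all of `W`, so the residue is a complement of the radical in `W`,
hence symplectic. -/
theorem IsDegenerateOn.exists_isResidue_of_mem_span [FiniteDimensional F V] {u : ℕ}
    (h : IsDegenerateOn B W r u) (hB : B.IsSymm) (he0 : e ≠ 0) (her : e ∈ F ∙ r) :
    ∃ U, IsResidue B W e U ∧ IsSymplecticOn B U u := by
  obtain ⟨c, rfl⟩ := Submodule.mem_span_singleton.1 her
  have hc : c ≠ 0 := by
    rintro rfl
    simp at he0
  have hspan : F ∙ (c • r) = F ∙ r := Submodule.span_singleton_smul_eq (IsUnit.mk0 c hc) r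
  obtain ⟨U', hU'⟩ := Submodule.exists_isCompl (F ∙ r)
  have hrW : F ∙ r ≤ W := (Submodule.span_singleton_le_iff_mem _ _).2 h.mem
  have hsup : F ∙ r ⊔ U' ⊓ W = W := by
    rw [← sup_inf_assoc_of_le _ hrW, hU'.sup_eq_top, top_inf_eq]
  have hdisj : ∀ x ∈ F ∙ r, x ∈ U' → x = 0 := fun x hx hx' =>
    Submodule.disjoint_def.1 hU'.disjoint x hx hx'
  have hr : IsResidue B W (c • r) (U' ⊓ W) :=
    { le := inf_le_right
      mem := W.smul_mem c h.mem
      isotropic := h.alternating _ (W.smul_mem c h.mem)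
      orthogonal := fun x hx => by simp [h.orthogonal x hx.2]
      notMem := fun hx => he0 (hdisj _ her hx.1)
      split := fun x hx _ => by
        rw [← hsup, ← hspan] at hx
        obtain ⟨y, hy, z, hz, rfl⟩ := Submodule.mem_sup.1 hx
        obtain ⟨a, rfl⟩ := Submodule.mem_span_singleton.1 hy
        exact ⟨a, by simpa using hz⟩ }
  refine ⟨_, hr, h.alternating.mono inf_le_right, ?_, ?_⟩
  · intro x hx h0
    refine hdisj x (h.radical x hx.2 fun y hy => ?_) hx.1
    rw [← hsup] at hy
    obtain ⟨z, hz, y, hy', rfl⟩ := Submodule.mem_sup.1 hy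
    obtain ⟨a, rfl⟩ := Submodule.mem_span_singleton.1 hz
    have : B x r = 0 := by rw [hB.eq]; exact h.orthogonal x hx.2
    simp [this, h0 y hy']
  · have h1 := hr.finrank_sup le_rfl
    rw [hspan, hsup, h.finrank_eq] at h1
    omega

variable [Finite V]

/-- This identifies the Witt index of `F^n` for `q` even and `n` odd. -/
theorem IsSymplecticOn.finrank_eq_of_isMaximalIsotropic (hB : B.IsSymm) (d : ℕ) :
    ∀ (W C : Submodule F V) (u : ℕ), IsSymplecticOn B W u → IsMaximalIsotropic B W C →
      finrank F C = d → u = d := by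
  induction d with
  | zero =>
    intro W C u hW hC hd
    rw [Submodule.finrank_eq_zero] at hd
    subst hd
    have hW0 : W = ⊥ := by
      rw [eq_bot_iff]
      intro x hx
      by_contra hx0
      have : x ∈ isoVectors B W := mem_isoVectors.2 ⟨hx, hx0, hW.alternating x hx⟩
      simp [hC.isoVectors_eq_empty] at this
    have := hW.finrank_eq
    rw [hW0, finrank_bot] at this
    omega
  | succ d ih =>
    intro W C u hW hC hd
    obtain ⟨e, he, he0⟩ : ∃ e ∈ C, e ≠ 0 := C.exists_mem_ne_zero_of_ne_bot (by
      rintro rfl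
      simp at hd)
    obtain ⟨U, hU, hUs, hu⟩ := hW.exists_isResidue hB (hC.prop.1 he) he0
    have h4 := hU.finrank_inf_add_one hC.prop.1 hC.prop.2 he
    have := ih _ _ _ hUs (hC.inf hB hU he) (by omega)
    omega

variable [Fintype F]

theorem IsAlternatingOn.card_isoVectors_add_one (h : IsAlternatingOn B W) :
    (isoVectors B W).card + 1 = Fintype.card F ^ finrank F W := by
  have : Fintype V := Fintype.ofFinite V
  rw [_root_.card_isoVectors_add_one, ← Nat.card_eq_fintype_card,
    ← Module.natCard_eq_pow_finrank (K := F) (V := W)]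
  exact Nat.card_congr (Equiv.subtypeUnivEquiv fun x => h x x.2)

/-- The parameter is `2u + 1`, not the dimension `2u`: all `q^(2u) - 1 = (q^u + 1)(q^u - 1)` nonzero
vectors are isotropic, as many as `tau` expects for `m = 2u + 1`. -/
theorem IsSymplecticOn.card_isoSubspaces (hB : B.IsSymm) {u : ℕ} (h : IsSymplecticOn B W u)
    (k : ℕ) : ((isoSubspaces B W k).card : ℚ) = tau (Fintype.card F) (2 * u + 1) k u := by
  refine card_isoSubspaces_eq_tau hB (fun W m u => IsSymplecticOn B W u ∧ m = 2 * u + 1)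
    ?_ ?_ k W _ u ⟨h, rfl⟩
  · rintro W m u ⟨h, rfl⟩
    have h1 := congrArg (Nat.cast (R := ℚ)) h.alternating.card_isoVectors_add_one
    push_cast [h.finrank_eq] at h1
    rw [eq_sub_of_add_eq h1, show 2 * u + 1 - u - 1 = u by omega]
    ring
  · rintro W m u ⟨h, rfl⟩ e he
    obtain ⟨he, he0, -⟩ := mem_isoVectors.1 he
    obtain ⟨U, hU, hUs, hu⟩ := h.exists_isResidue hB he he0
    exact ⟨U, hU, hUs, by omega⟩

/-- The number of `k`-dimensional self-orthogonal subspaces of an alternating space of dimension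
`2u + 1` over the field with `q` elements whose radical is a line. -/
def degenerateCount (q : ℕ) : ℕ → ℕ → ℚ
  | 0, _ => 1
  | k + 1, u => (((q : ℚ) - 1) * tau q (2 * u + 1) k u +
      ((q : ℚ) ^ (2 * u + 1) - q) * degenerateCount q k (u - 1)) / ((q : ℚ) ^ (k + 1) - 1)

/-- No closed form is needed, only that the count depends on `q`, `k` and `u` alone; this lets
residues in `F^n` be compared with `F^(n-2)`. For `u = 0` the truncated `u - 1` is multiplied by `q
- q = 0`. -/
theorem IsDegenerateOn.card_isoSubspaces (hB : B.IsSymm) (k : ℕ) :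
    ∀ (W : Submodule F V) (u : ℕ), IsDegenerateOn B W r u →
      ((isoSubspaces B W k).card : ℚ) = degenerateCount (Fintype.card F) k u := by
  classical
  have hq : 2 ≤ Fintype.card F := Fintype.one_lt_card
  induction k with
  | zero => intro W u _; rw [card_isoSubspaces_zero, degenerateCount, Nat.cast_one]
  | succ k ih =>
    intro W u h
    have : Fintype V := Fintype.ofFinite V
    have hpos : (1 : ℚ) < (Fintype.card F : ℚ) ^ (k + 1) :=
      one_lt_pow₀ (by exact_mod_cast hq) (by omega)
    rw [degenerateCount, eq_div_iff (by linarith), mul_comm, card_isoSubspaces_mul]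
    have hsum : ∀ e ∈ isoVectors B W,
        (((isoSubspaces B W (k + 1)).filter (e ∈ ·)).card : ℚ) = if e ∈ F ∙ r then
          tau (Fintype.card F) (2 * u + 1) k u else
          degenerateCount (Fintype.card F) k (u - 1) := by
      intro e he
      obtain ⟨he, he0, -⟩ := mem_isoVectors.1 he
      split_ifs with her
      · obtain ⟨U, hU, hUs⟩ := h.exists_isResidue_of_mem_span hB he0 her
        rw [hU.card_filter_mem hB, hUs.card_isoSubspaces hB]
      · obtain ⟨U, hU, hUs, -⟩ := h.exists_isResidue hB he her
        rw [hU.card_filter_mem hB, ih _ _ hUs]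
    rw [Finset.sum_congr rfl hsum, Finset.sum_ite, Finset.sum_const, Finset.sum_const,
      nsmul_eq_mul, nsmul_eq_mul]
    have hrW : F ∙ r ≤ W := (Submodule.span_singleton_le_iff_mem _ _).2 h.mem
    have h1 : (isoVectors B W).filter (· ∈ F ∙ r) = isoVectors B (F ∙ r) := by
      ext x
      simp only [Finset.mem_filter, mem_isoVectors]
      exact ⟨fun hx => ⟨hx.2, hx.1.2⟩, fun hx => ⟨⟨hrW hx.1, hx.2⟩, hx.1⟩⟩
    have h2 := (h.alternating.mono hrW).card_isoVectors_add_one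
    rw [finrank_span_singleton h.ne_zero, ← h1] at h2
    have h3 := h.alternating.card_isoVectors_add_one
    rw [h.finrank_eq, ← Finset.card_filter_add_card_filter_not (· ∈ F ∙ r)] at h3
    have h2' := congrArg (Nat.cast (R := ℚ)) h2
    have h3' := congrArg (Nat.cast (R := ℚ)) h3
    push_cast at h2' h3'
    rw [eq_sub_of_add_eq h2'] at h3' ⊢
    congr 1
    · ring
    · congr 1
      linear_combination h3'

end Alternating

/-! ### The dot product and the hyperplane orthogonal to the all-one vector. -/

section Codes

variable {F : Type*} [Field F]

@[simp] theorem dotForm_apply {n : ℕ} (v w : Fin n → F) : dotForm F n v w = v ⬝ᵥ w := rfl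

theorem dotForm_isSymm (n : ℕ) : (dotForm F n).IsSymm :=
  ⟨fun v w => dotProduct_comm v w⟩

theorem isNondegenerateOn_top (n : ℕ) : IsNondegenerateOn (dotForm F n) ⊤ := fun x _ h =>
  dotProduct_eq_zero x fun y => h y trivial

theorem exists_isMaximalIsotropic_wittIndex {V : Type*} [AddCommGroup V] [Module F V]
    [FiniteDimensional F V] (B : LinearMap.BilinForm F V) :
    ∃ C, IsMaximalIsotropic B ⊤ C ∧ finrank F C = wittIndex B := by
  have hb : BddAbove {d : ℕ | ∃ C : Submodule F V, IsSelfOrthogonal B C ∧ finrank F C = d} :=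
    ⟨finrank F V, by
      rintro d ⟨C, -, rfl⟩
      exact C.finrank_le⟩
  obtain ⟨C, hC, hd⟩ := Nat.sSup_mem (⟨0, ⊥, by simp [IsSelfOrthogonal], by simp⟩ :
    {d : ℕ | ∃ C : Submodule F V, IsSelfOrthogonal B C ∧ finrank F C = d}.Nonempty) hb
  refine ⟨C, ⟨⟨le_top, hC⟩, fun D hD hCD => ?_⟩, hd⟩
  refine (Submodule.eq_of_le_of_finrank_le hCD ?_).ge
  rw [hd]
  exact le_csSup hb ⟨D, hD.2, rfl⟩

/-- The vectors of `F^n` that are orthogonal to the all-one vector. -/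
def sumZero (F : Type*) [Field F] (n : ℕ) : Submodule F (Fin n → F) :=
  LinearMap.ker (dotForm F n 1)

@[simp] theorem mem_sumZero {n : ℕ} {x : Fin n → F} : x ∈ sumZero F n ↔ ∑ i, x i = 0 := by
  simp [sumZero, one_dotProduct]

theorem finrank_sumZero {n : ℕ} (hn : n ≠ 0) : finrank F (sumZero F n) + 1 = n := by
  have h : dotForm F n 1 ≠ 0 := fun h => by
    have := congrArg (fun φ => φ (Pi.single ⟨0, Nat.pos_of_ne_zero hn⟩ 1)) h
    simp at this
  exact (Module.Dual.finrank_ker_add_one_of_ne_zero h).trans (by simp)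

theorem eq_smul_one_of_orthogonal_sumZero {n : ℕ} {x : Fin n → F}
    (h : ∀ y ∈ sumZero F n, dotForm F n x y = 0) : ∃ c : F, x = c • 1 := by
  rcases Nat.eq_zero_or_pos n with rfl | hn
  · exact ⟨0, Subsingleton.elim _ _⟩
  · refine ⟨x ⟨0, hn⟩, funext fun i => ?_⟩
    -- Testing against a difference of two unit vectors forces equal coordinates.
    have := h (Pi.single i 1 - Pi.single ⟨0, hn⟩ 1) (by simp)
    simpa [dotProduct_sub, sub_eq_zero] using this

section CharTwo

variable [CharP F 2] {n : ℕ}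

/-- By additivity of squaring, isotropy is a linear condition, so self-orthogonal codes live in
`sumZero`. -/
theorem dotProduct_self_eq_zero_iff_sum (x : Fin n → F) : x ⬝ᵥ x = 0 ↔ ∑ i, x i = 0 := by
  have : x ⬝ᵥ x = (∑ i, x i) ^ 2 := by
    rw [CharTwo.sum_sq]
    exact Finset.sum_congr rfl fun i _ => (pow_two _).symm
  rw [this, pow_eq_zero_iff two_ne_zero]

theorem IsSelfOrthogonal.le_sumZero {C : Submodule F (Fin n → F)}
    (hC : IsSelfOrthogonal (dotForm F n) C) : C ≤ sumZero F n := fun x hx =>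
  mem_sumZero.2 ((dotProduct_self_eq_zero_iff_sum x).1 (isSelfOrthogonal_iff.1 hC x hx x hx))

theorem isAlternatingOn_sumZero (n : ℕ) : IsAlternatingOn (dotForm F n) (sumZero F n) :=
  fun x hx => (dotProduct_self_eq_zero_iff_sum x).2 (mem_sumZero.1 hx)

theorem isSymplecticOn_sumZero {u : ℕ} (hn : n = 2 * u + 1) :
    IsSymplecticOn (dotForm F n) (sumZero F n) u where
  alternating := isAlternatingOn_sumZero n
  nondegenerate x hx h := by
    obtain ⟨c, rfl⟩ := eq_smul_one_of_orthogonal_sumZero h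
    have h1 : (n : F) = 1 := by simp [hn, CharTwo.two_eq_zero]
    have h2 : c = 0 := by simpa [h1] using mem_sumZero.1 hx
    simp [h2]
  finrank_eq := by have := finrank_sumZero (F := F) (n := n) (by omega); omega

theorem isDegenerateOn_sumZero {u : ℕ} (hn : n = 2 * u + 2) :
    IsDegenerateOn (dotForm F n) (sumZero F n) 1 u where
  alternating := isAlternatingOn_sumZero n
  mem := by simp [hn, CharTwo.two_eq_zero]
  ne_zero h := by simpa using congrFun h ⟨0, by omega⟩
  orthogonal y hy := by simpa [one_dotProduct] using hy
  radical x _ h := by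
    obtain ⟨c, rfl⟩ := eq_smul_one_of_orthogonal_sumZero h
    exact Submodule.smul_mem _ _ (Submodule.mem_span_singleton_self _)
  finrank_eq := by have := finrank_sumZero (F := F) (n := n) (by omega); omega

theorem isoSubspaces_top_eq [Fintype F] (k : ℕ) :
    isoSubspaces (dotForm F n) ⊤ k = isoSubspaces (dotForm F n) (sumZero F n) k := by
  ext C
  simp only [mem_isoSubspaces]
  exact ⟨fun h => ⟨h.2.1.le_sumZero, h.2⟩, fun h => ⟨le_top, h.2⟩⟩

end CharTwo

variable [Fintype F]

theorem codes_eq_isoSubspaces (n k : ℕ) : codes F n k k = isoSubspaces (dotForm F n) ⊤ k := by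
  ext C
  simp only [codes, complementarySubspaces, IsComplementary, IsSelfOrthogonal,
    Set.Finite.mem_toFinset, Set.mem_ofPred_eq, mem_isoSubspaces, le_top, true_and]
  constructor
  · rintro ⟨h1, h2⟩
    refine ⟨?_, h1⟩
    rw [← inf_eq_left]
    exact Submodule.eq_of_le_of_finrank_eq inf_le_left (h2.trans h1.symm)
  · rintro ⟨h1, h2⟩
    exact ⟨h2, by rw [inf_eq_left.2 h1]; exact h2⟩

/-- The self-orthogonal vectors of Hamming weight `j`. -/
noncomputable def weightVectors (F : Type*) [Field F] [Fintype F] [DecidableEq F] (n j : ℕ) :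
    Finset (Fin n → F) :=
  Finset.univ.filter fun v => hammingNorm v = j ∧ v ⬝ᵥ v = 0

theorem sigmaCount_eq (n k : ℕ) :
    sigmaCount F n k = (isoSubspaces (dotForm F n) ⊤ k).card := by
  rw [sigmaCount, codes_eq_isoSubspaces]

variable [DecidableEq F]

theorem zetaCount_eq (n j : ℕ) : zetaCount F n j = (weightVectors F n j).card := by
  rw [zetaCount, weightVectors, ← Set.ncard_coe_finset]
  simp

theorem mem_isoVectors_of_mem_weightVectors {n j : ℕ} (hj : 0 < j) {v : Fin n → F}
    (hv : v ∈ weightVectors F n j) : v ∈ isoVectors (dotForm F n) ⊤ := by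
  simp only [weightVectors, Finset.mem_filter, Finset.mem_univ, true_and] at hv
  refine mem_isoVectors.2 ⟨trivial, ?_, hv.2⟩
  rintro rfl
  rw [hammingNorm_zero] at hv
  omega

-- Codewords of a self-orthogonal code are isotropic, so only `weightVectors` contribute after the
-- sums are exchanged.
open Classical in
theorem aggregateWeight_eq_sum (n k j : ℕ) : aggregateWeight F n k k j =
    ∑ v ∈ weightVectors F n j, ((isoSubspaces (dotForm F n) ⊤ k).filter (v ∈ ·)).card := by
  rw [aggregateWeight, codes_eq_isoSubspaces]
  refine Eq.trans (Finset.sum_congr rfl fun C hC => ?_)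
    (Finset.sum_card_bipartiteAbove_eq_sum_card_bipartiteBelow (fun C v => v ∈ C))
  have h := isSelfOrthogonal_iff.1 (mem_isoSubspaces.1 hC).2.1
  rw [weightCount, ← Set.ncard_coe_finset]
  congr 1
  ext v
  simp only [Finset.bipartiteAbove, weightVectors, Finset.coe_filter, Finset.mem_filter,
    Finset.mem_univ, true_and, Set.mem_ofPred_eq]
  exact ⟨fun hv => ⟨⟨hv.2, h v hv.1 v hv.1⟩, hv.1⟩, fun hv => ⟨hv.2, hv.1.1⟩⟩

theorem aggregateWeight_one {n j : ℕ} (hj : 0 < j) :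
    aggregateWeight F n 1 1 j = zetaCount F n j := by
  classical
  rw [aggregateWeight_eq_sum, zetaCount_eq, Finset.card_eq_sum_ones]
  refine Finset.sum_congr rfl fun v hv => ?_
  obtain ⟨-, hv0, hvv⟩ := mem_isoVectors.1 (mem_isoVectors_of_mem_weightVectors hj hv)
  rw [Finset.card_eq_one]
  refine ⟨F ∙ v, ?_⟩
  ext C
  simp only [Finset.mem_filter, mem_isoSubspaces, le_top, true_and, Finset.mem_singleton]
  constructor
  · rintro ⟨⟨-, h1⟩, hvC⟩
    refine (Submodule.eq_of_le_of_finrank_eq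
      ((Submodule.span_singleton_le_iff_mem _ _).2 hvC) ?_).symm
    rw [finrank_span_singleton hv0, h1]
  · rintro rfl
    refine ⟨⟨isSelfOrthogonal_iff.2 fun x hx y hy => ?_, finrank_span_singleton hv0⟩,
      Submodule.mem_span_singleton_self v⟩
    obtain ⟨a, rfl⟩ := Submodule.mem_span_singleton.1 hx
    obtain ⟨b, rfl⟩ := Submodule.mem_span_singleton.1 hy
    simp only [map_smul, LinearMap.smul_apply, hvv, smul_zero]

theorem aggregateWeight_of_odd {n j : ℕ} (h2 : (2 : F) ≠ 0) (hj : 0 < j) (k : ℕ) :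
    (aggregateWeight F n (k + 1) (k + 1) j : ℚ) = zetaCount F n j *
      tau (Fintype.card F) (n - 2) k (wittIndex (dotForm F n) - 1) := by
  classical
  obtain ⟨C, hC, hw⟩ := exists_isMaximalIsotropic_wittIndex (dotForm F n)
  have hB := dotForm_isSymm (F := F) n
  have h1 := hC.card_isoVectors hB h2 _ _ _ (isNondegenerateOn_top n) hw
  have hn : finrank F (⊤ : Submodule F (Fin n → F)) = n := by simp
  rw [hn] at h1
  have hP : HasPolarCount (dotForm F n) ⊤ n (wittIndex (dotForm F n)) :=
    ⟨isNondegenerateOn_top n, hn, h1.1, h1.2⟩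
  rw [aggregateWeight_eq_sum, zetaCount_eq, Nat.cast_sum, ← nsmul_eq_mul]
  refine Finset.sum_eq_card_nsmul fun v hv => ?_
  obtain ⟨U, hU, hUP⟩ := hP.exists_isResidue hB h2 (mem_isoVectors_of_mem_weightVectors hj hv)
  rw [hU.card_filter_mem hB, hUP.card_isoSubspaces hB h2]

/-! ### Aggregate weights in characteristic two. -/

section CharTwo

variable [CharP F 2] {n j : ℕ}

theorem mem_sumZero_of_mem_weightVectors {v : Fin n → F} (hv : v ∈ weightVectors F n j) :
    v ∈ sumZero F n := by
  simp only [weightVectors, Finset.mem_filter] at hv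
  exact mem_sumZero.2 ((dotProduct_self_eq_zero_iff_sum v).1 hv.2.2)

theorem aggregateWeight_of_charTwo_of_odd (hj : 0 < j) (hn : n % 2 = 1) (k : ℕ) :
    (aggregateWeight F n (k + 1) (k + 1) j : ℚ) = zetaCount F n j *
      tau (Fintype.card F) (n - 2) k (wittIndex (dotForm F n) - 1) := by
  classical
  obtain ⟨C, hC, hw⟩ := exists_isMaximalIsotropic_wittIndex (dotForm F n)
  have hB := dotForm_isSymm (F := F) n
  have hW := isSymplecticOn_sumZero (F := F) (n := n) (u := n / 2) (by omega)
  have hC' : IsMaximalIsotropic (dotForm F n) (sumZero F n) C :=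
    ⟨⟨hC.prop.2.le_sumZero, hC.prop.2⟩, fun D hD => hC.le_of_ge ⟨le_top, hD.2⟩⟩
  have h1 := IsSymplecticOn.finrank_eq_of_isMaximalIsotropic hB _ _ _ _ hW hC' hw
  rw [aggregateWeight_eq_sum, zetaCount_eq, Nat.cast_sum, ← nsmul_eq_mul, ← h1,
    isoSubspaces_top_eq]
  refine Finset.sum_eq_card_nsmul fun v hv => ?_
  obtain ⟨U, hU, hUs, h0⟩ := hW.exists_isResidue hB (mem_sumZero_of_mem_weightVectors hv)
    (mem_isoVectors.1 (mem_isoVectors_of_mem_weightVectors hj hv)).2.1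
  -- `h0` gives `n ≥ 3`, so neither subtraction truncates.
  rw [hU.card_filter_mem hB, hUs.card_isoSubspaces hB,
    show 2 * (n / 2 - 1) + 1 = n - 2 by omega]

omit [DecidableEq F] in
-- The residue has a radical of dimension one and total dimension `n - 3`, exactly like `sumZero` in
-- `F^(n-2)`.
theorem card_filter_mem_of_notMem_span_one (hn : n % 2 = 0) (k : ℕ) {v : Fin n → F}
    (hv : v ∈ sumZero F n) (hv1 : v ∉ F ∙ (1 : Fin n → F))
    [DecidablePred (v ∈ · : Submodule F (Fin n → F) → Prop)] :
    ((isoSubspaces (dotForm F n) ⊤ (k + 1)).filter (v ∈ ·)).card = sigmaCount F (n - 2) k := by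
  classical
  have hn0 : n ≠ 0 := by
    rintro rfl
    exact hv1 (Subsingleton.elim 0 v ▸ Submodule.zero_mem _)
  have hB := dotForm_isSymm (F := F) n
  have hW := isDegenerateOn_sumZero (F := F) (n := n) (u := n / 2 - 1) (by omega)
  obtain ⟨U, hU, hUd, h0⟩ := hW.exists_isResidue hB hv hv1
  have hW' := isDegenerateOn_sumZero (F := F) (n := n - 2) (u := n / 2 - 1 - 1) (by omega)
  have h1 := hU.card_filter_mem hB k
  have h2 := hUd.card_isoSubspaces hB k
  rw [← hW'.card_isoSubspaces (dotForm_isSymm _), Nat.cast_inj] at h2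
  rw [sigmaCount_eq, isoSubspaces_top_eq, isoSubspaces_top_eq, ← h2, ← h1]
  congr

omit [DecidableEq F] in
-- The residue is symplectic of dimension `n - 2`, like `sumZero` in `F^(n-1)`, where `n - 1` is
-- odd.
theorem card_filter_mem_of_mem_span_one (hn : n % 2 = 0) (k : ℕ) {v : Fin n → F}
    (hv0 : v ≠ 0) (hv1 : v ∈ F ∙ (1 : Fin n → F))
    [DecidablePred (v ∈ · : Submodule F (Fin n → F) → Prop)] :
    ((isoSubspaces (dotForm F n) ⊤ (k + 1)).filter (v ∈ ·)).card = sigmaCount F (n - 1) k := by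
  classical
  have hn0 : n ≠ 0 := by
    rintro rfl
    exact hv0 (Subsingleton.elim v 0)
  have hB := dotForm_isSymm (F := F) n
  have hW := isDegenerateOn_sumZero (F := F) (n := n) (u := n / 2 - 1) (by omega)
  obtain ⟨U, hU, hUs⟩ := hW.exists_isResidue_of_mem_span hB hv0 hv1
  have hW' := isSymplecticOn_sumZero (F := F) (n := n - 1) (u := n / 2 - 1) (by omega)
  have h1 := hU.card_filter_mem hB k
  have h2 := hUs.card_isoSubspaces hB k
  rw [← hW'.card_isoSubspaces (dotForm_isSymm _), Nat.cast_inj] at h2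
  rw [sigmaCount_eq, isoSubspaces_top_eq, isoSubspaces_top_eq, ← h2, ← h1]
  congr

omit [Fintype F] [CharP F 2] in
theorem hammingNorm_smul_one {c : F} (hc : c ≠ 0) : hammingNorm (c • (1 : Fin n → F)) = n := by
  simp [hammingNorm, hc]

theorem aggregateWeight_of_charTwo_of_lt (hj : 0 < j) (hjn : j < n) (hn : n % 2 = 0) (k : ℕ) :
    aggregateWeight F n (k + 1) (k + 1) j = zetaCount F n j * sigmaCount F (n - 2) k := by
  classical
  rw [aggregateWeight_eq_sum, zetaCount_eq, ← smul_eq_mul]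
  refine Finset.sum_eq_card_nsmul fun v hv => ?_
  refine card_filter_mem_of_notMem_span_one hn k (mem_sumZero_of_mem_weightVectors hv) ?_
  intro hv1
  have hv0 := (mem_isoVectors.1 (mem_isoVectors_of_mem_weightVectors hj hv)).2.1
  obtain ⟨c, rfl⟩ := Submodule.mem_span_singleton.1 hv1
  have hc : c ≠ 0 := by
    rintro rfl
    simp at hv0
  simp only [weightVectors, Finset.mem_filter, hammingNorm_smul_one hc] at hv
  omega

theorem card_weightVectors_filter_mem_span_one (hn0 : 0 < n) (hn : n % 2 = 0)
    [DecidablePred (· ∈ F ∙ (1 : Fin n → F))] :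
    ((weightVectors F n n).filter (· ∈ F ∙ (1 : Fin n → F))).card + 1 = Fintype.card F := by
  have hW := isDegenerateOn_sumZero (F := F) (n := n) (u := n / 2 - 1) (by omega)
  have hle : F ∙ (1 : Fin n → F) ≤ sumZero F n :=
    (Submodule.span_singleton_le_iff_mem _ _).2 hW.mem
  have h2 := (hW.alternating.mono hle).card_isoVectors_add_one
  rw [finrank_span_singleton hW.ne_zero, pow_one] at h2
  rw [← h2]
  congr 2
  ext v
  constructor
  · intro hv
    obtain ⟨hv, hv1⟩ := Finset.mem_filter.1 hv
    exact mem_isoVectors.2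
      ⟨hv1, (mem_isoVectors.1 (mem_isoVectors_of_mem_weightVectors hn0 hv)).2⟩
  · intro hv
    obtain ⟨hv1, hv0, hvv⟩ := mem_isoVectors.1 hv
    refine Finset.mem_filter.2 ⟨Finset.mem_filter.2 ⟨Finset.mem_univ _, ?_, hvv⟩, hv1⟩
    obtain ⟨c, rfl⟩ := Submodule.mem_span_singleton.1 hv1
    refine hammingNorm_smul_one ?_
    rintro rfl
    simp at hv0

/-- The `q - 1` nonzero multiples of `1` contribute `σ(n-1, k)` each, the other vectors of weight
`n` contribute `σ(n-2, k)`. -/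
theorem aggregateWeight_of_charTwo_self (hn0 : 0 < n) (hn : n % 2 = 0) (k : ℕ) :
    (aggregateWeight F n (k + 1) (k + 1) n : ℤ) = zetaCount F n n * sigmaCount F (n - 2) k +
      ((Fintype.card F : ℤ) - 1) *
        ((sigmaCount F (n - 1) k : ℤ) - sigmaCount F (n - 2) k) := by
  classical
  have hsum : ∀ v ∈ weightVectors F n n,
      ((isoSubspaces (dotForm F n) ⊤ (k + 1)).filter (v ∈ ·)).card =
        if v ∈ F ∙ (1 : Fin n → F) then sigmaCount F (n - 1) k else sigmaCount F (n - 2) k := by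
    intro v hv
    split_ifs with hv1
    · exact card_filter_mem_of_mem_span_one hn k
        (mem_isoVectors.1 (mem_isoVectors_of_mem_weightVectors hn0 hv)).2.1 hv1
    · exact card_filter_mem_of_notMem_span_one hn k (mem_sumZero_of_mem_weightVectors hv) hv1
  rw [aggregateWeight_eq_sum, zetaCount_eq, Finset.sum_congr rfl hsum, Finset.sum_ite,
    Finset.sum_const, Finset.sum_const, smul_eq_mul, smul_eq_mul,
    ← Finset.card_filter_add_card_filter_not (s := weightVectors F n n)
      (· ∈ F ∙ (1 : Fin n → F)), ← card_weightVectors_filter_mem_span_one (F := F) hn0 hn]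
  push_cast
  ring

end CharTwo

end Codes

theorem mainTheorem9 {F : Type*} [Field F] [Fintype F] [DecidableEq F] (q n w : ℕ)
    (hq : q = Fintype.card F) (hw : w = wittIndex (dotForm F n))
    (j k : ℕ) (hj : 0 < j) (hk : 1 ≤ k) (hkw : k ≤ w) :
    (codeType q n ∈ ({CodeType.P, CodeType.N1, CodeType.H, CodeType.E} : Set CodeType) →
      (aggregateWeight F n k k j : ℚ) = zetaCount F n j * tau q (n - 2) (k - 1) (w - 1)) ∧
    (codeType q n = CodeType.N0na → j < n →
      aggregateWeight F n k k j = zetaCount F n j * sigmaCount F (n - 2) (k - 1)) ∧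
    (codeType q n = CodeType.N0na → j = n →
      (aggregateWeight F n k k j : ℤ) =
        zetaCount F n n * sigmaCount F (n - 2) (k - 1) +
          ((q : ℤ) - 1) *
            ((sigmaCount F (n - 1) (k - 1) : ℤ) - sigmaCount F (n - 2) (k - 1))) ∧
    aggregateWeight F n 1 1 j = zetaCount F n j := by
  subst hq hw
  obtain ⟨k, rfl⟩ : ∃ l, k = l + 1 := ⟨k - 1, by omega⟩
  rw [Nat.add_sub_cancel]
  have hN0 : codeType (Fintype.card F) n = CodeType.N0na →
      Fintype.card F % 2 = 0 ∧ n % 2 = 0 := by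
    unfold codeType
    split_ifs with h1 h2 <;> simp [*]
  have hchar : Fintype.card F % 2 = 0 → CharP F 2 := fun h =>
    ringChar.of_eq (FiniteField.even_card_iff_char_two.2 h)
  refine ⟨fun h => ?_, fun h hjn => ?_, fun h hjn => ?_, aggregateWeight_one hj⟩
  -- The four types reduce to two cases: `q` odd, or `q` even with `n` odd. The finer type enters
  -- only through the Witt index.
  · by_cases h2 : Fintype.card F % 2 = 0
    · have := hchar h2
      refine aggregateWeight_of_charTwo_of_odd hj ?_ k
      by_contra hn
      have hn : n % 2 = 0 := by omega
      simp [codeType, h2, hn] at h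
    · refine aggregateWeight_of_odd (Ring.two_ne_zero fun h => h2 ?_) hj k
      exact FiniteField.even_card_iff_char_two.1 h
  · obtain ⟨h1, hn⟩ := hN0 h
    have := hchar h1
    exact aggregateWeight_of_charTwo_of_lt hj hjn hn k
  · obtain ⟨h1, hn⟩ := hN0 h
    have := hchar h1
    subst hjn
    exact aggregateWeight_of_charTwo_self hj hn k
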